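/- For $f:\mathbb{R}^d\to\mathbb{R}$ and $\sigma\ge 0$ let $$f_\sigma(x)=\frac{1}{\pi^{d/2}}\int_{\mathbb{R}^d} f(x+\sigma u)\,e^{-\|u\|^2}\,du ,$$ so that $f_0=f$; we say that $f_\sigma$ exists if this integral converges absolutely for every $x\in\mathbb{R}^d$. We say that $f$ attains its initial value at $x$ if $f_s(x)\to f(x)$ as $s\to0^+$. Let $S>0$ and $A,a\in\mathbb{R}$, and let $f:\mathbb{R}^d\to\mathbb{R}$ be such that $f_\sigma$ exists and $|f_\sigma(x)|\le Ae^{a\|x\|^2}$ for all $0\le\sigma\le S$ and $x\in\mathbb{R}^d$. Assume also that $u(x,t)=f_{2\sqrt t}(x)$ satisfies the heat equation: $u(x,0)=f(x)$ for all $x$ and, for $0<t<S^2/4$, $u(\cdot,t)$ is $C^2$ and $u_t=\Delta u$ pointwise on $\mathbb{R}^d$. Then the following hold. (a) If $f_\sigma$ is constant for some $0\le\sigma\le S$, then for all $\eta>0$ the function $f_\eta$ exists, $f_\eta=f$ almost everywhere, and $f_\eta(x)=f(x)$ at every $x$ at which $f$ attains its initial value. (b) Let $g:\mathbb{R}^d\to\mathbb{R}$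 and $B,b\in\mathbb{R}$ be such that $g_\sigma$ exists and $|g_\sigma(x)|\le Be^{b\|x\|^2}$ for all $0\le\sigma\le S$ and $x\in\mathbb{R}^d$. If for some $0\le\sigma\le S$ we have $f_\sigma(x)=g_\sigma(x)$ for all $x\in\mathbb{R}^d$, then $f=g$ almost everywhere. (c) If there is $0<\sigma\le S$ such that for all $\tau\ge\sigma$ the function $f_\tau$ exists and $f_\sigma=f_\tau$ everywhere, then for all $\eta>0$ the function $f_\eta$ exists and $f=f_\eta$ almost everywhere. (d) Suppose $f$ is bounded and non-convex, and suppose that $f$ attains its initial value at every $x\in\mathbb{R}^d$ or that $f$ is not almost everywhere equal to a convex function. Then for all $\sigma\ge0$ the function $f_\sigma$ exists and is non-convex. -/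

import Mathlib

open MeasureTheory Filter Topology Set

/-- The Gaussian smoothing `f_σ(x) = π^(-d/2) ∫ f(x + σ u) exp(-‖u‖²) du` on Euclidean `ℝᵈ`.
At `σ = 0` the formula gives back `f`. -/
noncomputable def gaussianSmoothing {d : ℕ} (f : EuclideanSpace ℝ (Fin d) → ℝ) (σ : ℝ)
    (x : EuclideanSpace ℝ (Fin d)) : ℝ :=
  1 / Real.pi ^ ((d : ℝ) / 2) *
    ∫ u : EuclideanSpace ℝ (Fin d), f (x + σ • u) * Real.exp (-‖u‖ ^ 2)

/-- `f_σ` is defined: the integral defining `f_σ(x)` converges absolutely for every `x`. -/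
def SmoothingExists {d : ℕ} (f : EuclideanSpace ℝ (Fin d) → ℝ) (σ : ℝ) : Prop :=
  ∀ x : EuclideanSpace ℝ (Fin d),
    Integrable (fun u : EuclideanSpace ℝ (Fin d) => f (x + σ • u) * Real.exp (-‖u‖ ^ 2)) volume

/-- `u(t, x)` satisfies the heat equation `u_t = Δ u` pointwise on `(0, T) × ℝᵈ`, with
`u(0, ·) = f`: each `u(t, ·)` is `C²` and the time derivative exists and equals the Laplacian. -/
def SolvesHeatEquation {d : ℕ} (u : ℝ → EuclideanSpace ℝ (Fin d) → ℝ)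
    (f : EuclideanSpace ℝ (Fin d) → ℝ) (T : ℝ) : Prop :=
  (∀ x, u 0 x = f x) ∧
    ∀ t : ℝ, 0 < t → t < T →
      ContDiff ℝ 2 (u t) ∧
        ∀ x, HasDerivAt (fun s => u s x) (Laplacian.laplacian (u t) x) t

/-- The initial value is attained at `x`: `f_s(x) → f(x)` as `s → 0⁺`. -/
def AttainsInitialValueAt {d : ℕ} (f : EuclideanSpace ℝ (Fin d) → ℝ)
    (x : EuclideanSpace ℝ (Fin d)) : Prop :=
  Tendsto (fun s : ℝ => gaussianSmoothing f s x) (𝓝[>] 0) (𝓝 (f x))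

/-!
The Gaussian smoothing `f ↦ f_σ` with `σ > 0` is injective modulo null sets
(`ae_eq_of_gaussianSmoothing_eq`), and all four parts rest on this.

Injectivity comes from completing the square: `f_σ(σ x / 2)` is, up to a positive factor
depending on `x` only, `∫ w(y) exp ⟪x, y⟫ dy` with `w(y) = f(σ y) exp(-‖y‖²)`. If `f_σ = 0`, then
the measures with densities `w⁺` and `w⁻` have the same everywhere finite moment generating
function, hence by analytic continuation the same characteristic function, hence they agree
(`ae_eq_zero_of_integral_mul_exp_inner_eq_zero`).

* If `f_σ` is a constant `c`, it is the smoothing of the constant `c`, so `f = c` almost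
  everywhere. Every `f_η` with `η > 0` is then `c`, and an attained initial value must be `c`.
* By the semigroup law `(f_η)_σ = f_√(σ² + η²)` (`SmoothingExists.semigroup`), if `f_τ = f_σ` for
  all `τ ≥ σ` then `f_η` and `f` have the same smoothing at scale `σ`, so `f_η = f` almost
  everywhere.
* If `f` is bounded, so is `f_σ`. A bounded convex function on the whole space is constant
  (`ConvexOn.eq_of_bounded`), so convexity of `f_σ` makes `f` almost everywhere constant.
-/

open scoped RealInnerProductSpace

/-! ### Vanishing two-sided Laplace transforms -/

/-- An integrable function whose two-sided Laplace transform exists and vanishes at every real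
point is zero almost everywhere. -/
theorem ae_eq_zero_of_integral_mul_exp_inner_eq_zero {d : ℕ} {w : EuclideanSpace ℝ (Fin d) → ℝ}
    (hint : ∀ x, Integrable (fun y => w y * Real.exp ⟪x, y⟫))
    (hzero : ∀ x, ∫ y, w y * Real.exp ⟪x, y⟫ = 0) : w =ᵐ[volume] 0 := by
  have hw : Integrable w := by simpa using hint 0
  set μ : Measure (EuclideanSpace ℝ (Fin d)) :=
    volume.withDensity fun y => ENNReal.ofReal (w y) with hμ
  set ν : Measure (EuclideanSpace ℝ (Fin d)) :=
    volume.withDensity fun y => ENNReal.ofReal (-w y) with hν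
  have hwm : AEMeasurable (fun y => ENNReal.ofReal (w y)) volume :=
    hw.aestronglyMeasurable.aemeasurable.ennreal_ofReal
  have hwm' : AEMeasurable (fun y => ENNReal.ofReal (-w y)) volume :=
    hw.aestronglyMeasurable.aemeasurable.neg.ennreal_ofReal
  have : IsFiniteMeasure μ := isFiniteMeasure_withDensity_ofReal hw.2
  have : IsFiniteMeasure ν := isFiniteMeasure_withDensity_ofReal hw.neg.2
  have hpos : ∀ x, Integrable (fun y => max (w y) 0 * Real.exp ⟪x, y⟫) := by
    intro x
    refine (hint x).pos_part.congr (Eventually.of_forall fun y => ?_)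
    simp only
    rw [max_mul_of_nonneg _ _ (Real.exp_pos _).le, zero_mul]
  have hneg : ∀ x, Integrable (fun y => max (-w y) 0 * Real.exp ⟪x, y⟫) := by
    intro x
    refine (hint x).neg_part.congr (Eventually.of_forall fun y => ?_)
    simp only
    rw [max_mul_of_nonneg _ _ (Real.exp_pos _).le, zero_mul, neg_mul]
  have hiμ : ∀ x, Integrable (fun y => Real.exp ⟪x, y⟫) μ := by
    intro x
    rw [hμ, integrable_withDensity_iff_integrable_smul₀' hwm (by simp)]
    simpa [ENNReal.toReal_ofReal'] using hpos x
  have hmgf : ∀ x, ∫ y, Real.exp ⟪x, y⟫ ∂μ = ∫ y, Real.exp ⟪x, y⟫ ∂ν := by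
    intro x
    rw [hμ, hν, integral_withDensity_eq_integral_toReal_smul₀ hwm (by simp),
      integral_withDensity_eq_integral_toReal_smul₀ hwm' (by simp), ← sub_eq_zero]
    simp only [ENNReal.toReal_ofReal', smul_eq_mul]
    rw [← integral_sub (hpos x) (hneg x)]
    refine Eq.trans ?_ (hzero x)
    refine integral_congr_ae (Eventually.of_forall fun y => ?_)
    simp only
    rw [← sub_mul]
    congr 1
    rcases le_total 0 (w y) with h | h <;> simp [h]
  -- Equality of the total masses is required by the comparison of complex moment generating
  -- functions below.
  have hmass : μ = 0 ↔ ν = 0 := by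
    have h0 := hmgf 0
    simp only [inner_zero_left, Real.exp_zero, integral_const, smul_eq_mul, mul_one] at h0
    rw [← Measure.measure_univ_eq_zero, ← Measure.measure_univ_eq_zero,
      (ENNReal.toReal_eq_toReal_iff' (measure_ne_top _ _) (measure_ne_top _ _)).1 h0]
  have hμν : μ = ν := by
    refine Measure.ext_of_charFun (funext fun x => ?_)
    have hm : ProbabilityTheory.mgf (fun y => ⟪x, y⟫) μ
        = ProbabilityTheory.mgf (fun y => ⟪x, y⟫) ν := by
      funext t
      simpa [ProbabilityTheory.mgf, inner_smul_left] using hmgf (t • x)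
    -- The value of the complex moment generating function of `⟪x, ·⟫` at `i` is the
    -- characteristic function at `x`.
    have hI : Complex.I.re ∈ interior
        (ProbabilityTheory.integrableExpSet (fun y => ⟪x, y⟫) μ) := by
      have : ProbabilityTheory.integrableExpSet (fun y => ⟪x, y⟫) μ = univ := by
        refine eq_univ_of_forall fun t => ?_
        simpa [ProbabilityTheory.integrableExpSet, inner_smul_left] using hiμ (t • x)
      simp [this]
    have := ProbabilityTheory.eqOn_complexMGF_of_mgf' hm hmass hI
    simp only [ProbabilityTheory.complexMGF] at this
    simp only [charFun_apply]
    simpa only [real_inner_comm, mul_comm] using this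
  have hae := (withDensity_eq_iff_of_sigmaFinite hwm hwm').1 hμν
  filter_upwards [hae] with y hy
  rcases le_total 0 (w y) with h | h
  · have h2 : ENNReal.ofReal (-w y) = 0 := ENNReal.ofReal_of_nonpos (by linarith)
    rw [h2, ENNReal.ofReal_eq_zero] at hy
    exact le_antisymm hy h
  · have h2 : ENNReal.ofReal (w y) = 0 := ENNReal.ofReal_of_nonpos h
    rw [h2, eq_comm, ENNReal.ofReal_eq_zero] at hy
    exact le_antisymm h (by simpa using hy)

/-! ### The Gaussian measure and the semigroup law -/

/-- The probability measure on `ℝᵈ` with density `π^(-d/2) exp(-‖u‖²)`, the law of a centred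
Gaussian with covariance `1/2` times the identity; `f_σ(x)` is the expectation of
`f(x + σ u)`. -/
noncomputable def gaussianMeasure (d : ℕ) : Measure (EuclideanSpace ℝ (Fin d)) :=
  volume.withDensity fun u =>
    ENNReal.ofReal (1 / Real.pi ^ ((d : ℝ) / 2) * Real.exp (-‖u‖ ^ 2))

theorem integrable_gaussianMeasure_iff {d : ℕ} {g : EuclideanSpace ℝ (Fin d) → ℝ} :
    Integrable g (gaussianMeasure d) ↔ Integrable fun u => g u * Real.exp (-‖u‖ ^ 2) := by
  rw [gaussianMeasure, integrable_withDensity_iff_integrable_smul' (by fun_prop) (by simp)]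
  have hc : (1 / Real.pi ^ ((d : ℝ) / 2)) ≠ 0 := by positivity
  rw [← integrable_const_mul_iff (isUnit_iff_ne_zero.2 hc)
    fun u => g u * Real.exp (-‖u‖ ^ 2)]
  refine integrable_congr (Eventually.of_forall fun u => ?_)
  simp only
  rw [ENNReal.toReal_ofReal (by positivity), smul_eq_mul]
  ring

theorem integral_gaussianMeasure {F : Type*} [NormedAddCommGroup F] [NormedSpace ℝ F] {d : ℕ}
    (g : EuclideanSpace ℝ (Fin d) → F) :
    ∫ u, g u ∂gaussianMeasure d
      = (1 / Real.pi ^ ((d : ℝ) / 2)) • ∫ u, Real.exp (-‖u‖ ^ 2) • g u := by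
  rw [gaussianMeasure, integral_withDensity_eq_integral_toReal_smul (by fun_prop) (by simp),
    ← integral_smul]
  refine integral_congr_ae (Eventually.of_forall fun u => ?_)
  simp only
  rw [ENNReal.toReal_ofReal (by positivity), mul_smul]

theorem gaussianSmoothing_eq_integral {d : ℕ} (f : EuclideanSpace ℝ (Fin d) → ℝ) (σ : ℝ)
    (x : EuclideanSpace ℝ (Fin d)) :
    gaussianSmoothing f σ x = ∫ u, f (x + σ • u) ∂gaussianMeasure d := by
  simp [integral_gaussianMeasure, gaussianSmoothing, mul_comm (Real.exp _)]

theorem smoothingExists_iff {d : ℕ} {f : EuclideanSpace ℝ (Fin d) → ℝ} {σ : ℝ} :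
    SmoothingExists f σ ↔ ∀ x, Integrable (fun u => f (x + σ • u)) (gaussianMeasure d) :=
  forall_congr' fun _ => integrable_gaussianMeasure_iff.symm

instance isProbabilityMeasure_gaussianMeasure (d : ℕ) :
    IsProbabilityMeasure (gaussianMeasure d) := by
  constructor
  rw [gaussianMeasure, withDensity_apply _ MeasurableSet.univ, Measure.restrict_univ,
    ← ofReal_integral_eq_lintegral_ofReal, integral_const_mul]
  · have h := GaussianFourier.integral_rexp_neg_mul_sq_norm
      (V := EuclideanSpace ℝ (Fin d)) (b := 1) one_pos
    simp only [neg_mul, one_mul, div_one, finrank_euclideanSpace, Fintype.card_fin] at h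
    rw [h, one_div, inv_mul_cancel₀ (by positivity), ENNReal.ofReal_one]
  · have h := GaussianFourier.integrable_cexp_neg_mul_sq_norm_add
      (V := EuclideanSpace ℝ (Fin d)) (b := 1) (by simp) 0 0
    refine Integrable.const_mul ?_ _
    refine h.re.congr (Eventually.of_forall fun u => ?_)
    simp only [neg_mul, one_mul, zero_mul, add_zero]
    rw [← Complex.ofReal_pow, ← Complex.ofReal_neg, ← Complex.ofReal_exp]
    exact Complex.ofReal_re _
  · exact Eventually.of_forall fun u => by positivity

theorem charFun_gaussianMeasure {d : ℕ} (t : EuclideanSpace ℝ (Fin d)) :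
    charFun (gaussianMeasure d) t = Complex.exp (-(‖t‖ : ℂ) ^ 2 / 4) := by
  rw [charFun_apply, integral_gaussianMeasure]
  have h := GaussianFourier.integral_cexp_neg_mul_sq_norm_add
    (V := EuclideanSpace ℝ (Fin d)) (b := 1) (by simp) Complex.I t
  simp only [finrank_euclideanSpace, Fintype.card_fin, div_one, Complex.I_sq, mul_one,
    neg_one_mul] at h
  have h2 : ∫ u : EuclideanSpace ℝ (Fin d),
      Real.exp (-‖u‖ ^ 2) • Complex.exp (⟪u, t⟫ * Complex.I)
      = ∫ u : EuclideanSpace ℝ (Fin d),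
        Complex.exp (-(‖u‖ : ℂ) ^ 2 + Complex.I * ⟪t, u⟫) := by
    refine integral_congr_ae (Eventually.of_forall fun u => ?_)
    simp only
    rw [Complex.real_smul, Complex.ofReal_exp, ← Complex.exp_add, real_inner_comm]
    push_cast
    ring_nf
  rw [h2, h, Complex.real_smul, ← mul_assoc]
  have h3 : ((1 / Real.pi ^ ((d : ℝ) / 2) : ℝ) : ℂ) * (Real.pi : ℂ) ^ ((d : ℂ) / 2) = 1 := by
    have : (Real.pi : ℂ) ^ ((d : ℂ) / 2) = ((Real.pi ^ ((d : ℝ) / 2) : ℝ) : ℂ) := by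
      rw [Complex.ofReal_cpow Real.pi_pos.le]
      push_cast
      rfl
    rw [this, ← Complex.ofReal_mul, one_div, inv_mul_cancel₀ (by positivity), Complex.ofReal_one]
  rw [h3, one_mul]

/-- If `u` and `v` are independent with law `gaussianMeasure d`, then `s u + t v` and
`√(s² + t²) u` have the same law. -/
theorem map_smul_add_smul_gaussianMeasure (d : ℕ) (s t : ℝ) :
    ((gaussianMeasure d).prod (gaussianMeasure d)).map (fun p => s • p.1 + t • p.2)
      = (gaussianMeasure d).map (fun u => √(s ^ 2 + t ^ 2) • u) := by
  have : IsProbabilityMeasure ((gaussianMeasure d).map (fun u => s • u)) :=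
    Measure.isProbabilityMeasure_map (by fun_prop)
  have : IsProbabilityMeasure ((gaussianMeasure d).map (fun u => t • u)) :=
    Measure.isProbabilityMeasure_map (by fun_prop)
  have h : ((gaussianMeasure d).prod (gaussianMeasure d)).map (fun p => s • p.1 + t • p.2)
      = (((gaussianMeasure d).map (fun u => s • u)).prod
        ((gaussianMeasure d).map (fun u => t • u))).map (fun p => p.1 + p.2) := by
    rw [Measure.map_prod_map _ _ (by fun_prop) (by fun_prop),
      Measure.map_map (by fun_prop) (by fun_prop)]
    rfl
  refine Measure.ext_of_charFun ?_
  rw [h, ProbabilityTheory.charFun_map_add_prod_eq_mul]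
  funext x
  simp only [Pi.mul_apply, charFun_map_smul, charFun_gaussianMeasure, norm_smul, Real.norm_eq_abs,
    ← Complex.exp_add, ← Complex.ofReal_pow, mul_pow, sq_abs]
  rw [Real.sq_sqrt (by positivity)]
  push_cast
  ring_nf

/-- Semigroup law `(f_t)_s = f_√(s² + t²)`. Existence of the right-hand side suffices: for any `f`,
absolute convergence of the iterated integral comes from Fubini's theorem. -/
theorem SmoothingExists.semigroup {d : ℕ} {f : EuclideanSpace ℝ (Fin d) → ℝ} {s t : ℝ}
    (hs : 0 < s) (hf : SmoothingExists f √(s ^ 2 + t ^ 2)) :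
    SmoothingExists (gaussianSmoothing f t) s ∧
      ∀ x, gaussianSmoothing (gaussianSmoothing f t) s x
        = gaussianSmoothing f √(s ^ 2 + t ^ 2) x := by
  have hr : √(s ^ 2 + t ^ 2) ≠ 0 := by positivity
  have hemb : MeasurableEmbedding
      (fun u : EuclideanSpace ℝ (Fin d) => √(s ^ 2 + t ^ 2) • u) :=
    (Homeomorph.smulOfNeZero _ hr).measurableEmbedding
  rw [smoothingExists_iff] at hf
  have hmap : ∀ x, Integrable (fun z => f (x + z))
      (((gaussianMeasure d).prod (gaussianMeasure d)).map (fun p => s • p.1 + t • p.2)) := by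
    intro x
    rw [map_smul_add_smul_gaussianMeasure, hemb.integrable_map_iff]
    exact hf x
  have hprod : ∀ x, Integrable
      (fun p : EuclideanSpace ℝ (Fin d) × EuclideanSpace ℝ (Fin d) =>
        f (x + s • p.1 + t • p.2)) ((gaussianMeasure d).prod (gaussianMeasure d)) := by
    intro x
    simpa only [add_assoc] using! (hmap x).comp_measurable (by fun_prop)
  constructor
  · rw [smoothingExists_iff]
    intro x
    simp only [gaussianSmoothing_eq_integral]
    exact (hprod x).integral_prod_left
  · intro x
    simp only [gaussianSmoothing_eq_integral]
    rw [← integral_prod _ (hprod x), ← hemb.integral_map (fun z => f (x + z)),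
      ← map_smul_add_smul_gaussianMeasure,
      integral_map (by fun_prop) (hmap x).aestronglyMeasurable]
    simp only [add_assoc]

/-! ### Injectivity of the smoothing -/

theorem quasiMeasurePreserving_smul {d : ℕ} {r : ℝ} (hr : r ≠ 0) :
    Measure.QuasiMeasurePreserving (fun y : EuclideanSpace ℝ (Fin d) => r • y) volume volume := by
  refine ⟨by fun_prop, ?_⟩
  rw [Measure.map_addHaar_smul _ hr]
  exact Measure.smul_absolutelyContinuous

theorem ae_eq_zero_of_gaussianSmoothing_eq_zero {d : ℕ} {f : EuclideanSpace ℝ (Fin d) → ℝ}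
    {σ : ℝ} (hσ : 0 < σ) (hf : SmoothingExists f σ) (h0 : ∀ x, gaussianSmoothing f σ x = 0) :
    f =ᵐ[volume] 0 := by
  -- Completing the square; the shift by `x / 2` makes the exponent of the cross term `⟪x, y⟫`.
  have key : ∀ x y : EuclideanSpace ℝ (Fin d),
      Real.exp (-‖y - (2⁻¹ : ℝ) • x‖ ^ 2) = Real.exp (-‖(2⁻¹ : ℝ) • x‖ ^ 2) *
        (Real.exp (-‖y‖ ^ 2) * Real.exp ⟪x, y⟫) := by
    intro x y
    rw [← Real.exp_add, ← Real.exp_add, norm_sub_sq_real, inner_smul_right, real_inner_comm]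
    ring_nf
  have hshift : ∀ x : EuclideanSpace ℝ (Fin d), (fun y => f (σ • y) * Real.exp (-‖y‖ ^ 2)
      * Real.exp ⟪x, y⟫) = fun y => Real.exp (‖(2⁻¹ : ℝ) • x‖ ^ 2) *
        (fun u => f (σ • (2⁻¹ : ℝ) • x + σ • u) * Real.exp (-‖u‖ ^ 2)) (y - (2⁻¹ : ℝ) • x) := by
    intro x
    funext y
    simp only [smul_sub, add_sub_cancel]
    rw [key, mul_left_comm, ← mul_assoc (Real.exp (‖_‖ ^ 2)), ← Real.exp_add]
    simp [mul_assoc]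
  have hw := ae_eq_zero_of_integral_mul_exp_inner_eq_zero
    (w := fun y => f (σ • y) * Real.exp (-‖y‖ ^ 2))
    (fun x => by
      rw [hshift]
      exact ((hf _).comp_sub_right _).const_mul _)
    (fun x => by
      rw [hshift, integral_const_mul, integral_sub_right_eq_self
        (fun u => f (σ • (2⁻¹ : ℝ) • x + σ • u) * Real.exp (-‖u‖ ^ 2))]
      have := h0 (σ • (2⁻¹ : ℝ) • x)
      rw [gaussianSmoothing, mul_eq_zero] at this
      rw [this.resolve_left (by positivity), mul_zero])
  filter_upwards [(quasiMeasurePreserving_smul (inv_ne_zero hσ.ne')).ae hw] with y hy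
  simpa [smul_smul, hσ.ne'] using hy

/-! ### Smoothing of constants and of almost everywhere equal functions -/

theorem gaussianSmoothing_zero {d : ℕ} (f : EuclideanSpace ℝ (Fin d) → ℝ) :
    gaussianSmoothing f 0 = f := by
  funext x
  simp [gaussianSmoothing_eq_integral]

theorem gaussianSmoothing_congr_ae {d : ℕ} {f g : EuclideanSpace ℝ (Fin d) → ℝ}
    (h : f =ᵐ[volume] g) {σ : ℝ} (hσ : 0 < σ) :
    (SmoothingExists g σ → SmoothingExists f σ) ∧
      gaussianSmoothing f σ = gaussianSmoothing g σ := by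
  have hae : ∀ x : EuclideanSpace ℝ (Fin d),
      (fun u => f (x + σ • u) * Real.exp (-‖u‖ ^ 2)) =ᵐ[volume]
        fun u => g (x + σ • u) * Real.exp (-‖u‖ ^ 2) := by
    intro x
    have hq := (measurePreserving_add_left (volume : Measure (EuclideanSpace ℝ (Fin d)))
      x).quasiMeasurePreserving.comp
        (quasiMeasurePreserving_smul hσ.ne')
    filter_upwards [hq.ae h] with u hu
    simp only [Function.comp_apply] at hu
    rw [hu]
  refine ⟨fun hg x => (hg x).congr (hae x).symm, funext fun x => ?_⟩
  rw [gaussianSmoothing, gaussianSmoothing, integral_congr_ae (hae x)]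

theorem smoothingExists_const {d : ℕ} (c σ : ℝ) :
    SmoothingExists (fun _ : EuclideanSpace ℝ (Fin d) => c) σ :=
  smoothingExists_iff.2 fun _ => integrable_const _

theorem gaussianSmoothing_const {d : ℕ} (c σ : ℝ) :
    gaussianSmoothing (fun _ : EuclideanSpace ℝ (Fin d) => c) σ = fun _ => c := by
  funext x
  simp [gaussianSmoothing_eq_integral]

/-- Two functions with equal smoothings at a single scale `σ ≥ 0` agree almost everywhere. -/
theorem ae_eq_of_gaussianSmoothing_eq {d : ℕ} {f g : EuclideanSpace ℝ (Fin d) → ℝ} {σ : ℝ}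
    (hσ : 0 ≤ σ) (hf : SmoothingExists f σ) (hg : SmoothingExists g σ)
    (h : ∀ x, gaussianSmoothing f σ x = gaussianSmoothing g σ x) : f =ᵐ[volume] g := by
  rcases hσ.eq_or_lt with rfl | hσ
  · simp only [gaussianSmoothing_zero] at h
    exact Eventually.of_forall h
  have hsub : SmoothingExists (f - g) σ := fun x => by
    simpa [sub_mul] using! (hf x).sub (hg x)
  have h0 : ∀ x, gaussianSmoothing (f - g) σ x = 0 := fun x => by
    have := h x
    rw [gaussianSmoothing_eq_integral, gaussianSmoothing_eq_integral] at this
    rw [gaussianSmoothing_eq_integral]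
    simp only [Pi.sub_apply]
    rw [integral_sub (smoothingExists_iff.1 hf x) (smoothingExists_iff.1 hg x), this, sub_self]
  filter_upwards [ae_eq_zero_of_gaussianSmoothing_eq_zero hσ hsub h0] with x hx
  exact sub_eq_zero.1 hx

theorem AttainsInitialValueAt.eq_of_ae_eq_const {d : ℕ} {f : EuclideanSpace ℝ (Fin d) → ℝ}
    {c : ℝ} (hfc : f =ᵐ[volume] fun _ => c) {x : EuclideanSpace ℝ (Fin d)}
    (hx : AttainsInitialValueAt f x) : f x = c := by
  refine tendsto_nhds_unique hx ((tendsto_congr' ?_).2 tendsto_const_nhds)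
  filter_upwards [self_mem_nhdsWithin] with s hs
  rw [(gaussianSmoothing_congr_ae hfc hs).2, gaussianSmoothing_const]

/-! ### Bounded functions -/

/-- The smoothing of a bounded function exists at every scale once it exists at one positive scale
`S`; the latter enters only through the measurability of `f`. -/
theorem smoothingExists_of_bounded {d : ℕ} {f : EuclideanSpace ℝ (Fin d) → ℝ} {C S : ℝ}
    (hS : 0 < S) (hf : SmoothingExists f S) (hC : ∀ x, |f x| ≤ C) {σ : ℝ} (hσ : 0 ≤ σ) :
    SmoothingExists f σ := by
  rcases hσ.eq_or_lt with rfl | hσ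
  · rw [smoothingExists_iff]
    intro x
    simp
  have hm : ∀ x, AEStronglyMeasurable
      (fun u => f (x + σ • u)) (volume : Measure (EuclideanSpace ℝ (Fin d))) := by
    intro x
    have h1 : AEStronglyMeasurable (fun u => f (x + S • u))
        (volume : Measure (EuclideanSpace ℝ (Fin d))) := by
      have h2 := (hf x).aestronglyMeasurable.mul
        (Continuous.aestronglyMeasurable (f := fun u => Real.exp (‖u‖ ^ 2)) (by fun_prop))
      refine h2.congr (Eventually.of_forall fun u => ?_)
      simp only [Pi.mul_apply]
      rw [mul_assoc, ← Real.exp_add, neg_add_cancel, Real.exp_zero, mul_one]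
    have h3 := h1.comp_quasiMeasurePreserving
      (quasiMeasurePreserving_smul (r := S⁻¹ * σ) (by positivity))
    simpa only [Function.comp_def, smul_smul, mul_inv_cancel_left₀ hS.ne'] using h3
  rw [smoothingExists_iff]
  intro x
  refine Integrable.of_bound ((hm x).mono_ac (withDensity_absolutelyContinuous _ _)) C
    (Eventually.of_forall fun u => hC _)

/-- A bounded convex function on a whole vector space is constant. -/
theorem ConvexOn.eq_of_bounded {E : Type*} [AddCommGroup E] [Module ℝ E] {f : E → ℝ}
    (hf : ConvexOn ℝ univ f) {C : ℝ} (hC : ∀ x, |f x| ≤ C) (x y : E) : f x = f y := by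
  suffices h : ∀ x y, f x ≤ f y from le_antisymm (h x y) (h y x)
  intro x y
  by_contra! hlt
  have hδ : 0 < f x - f y := sub_pos.2 hlt
  have hC0 : 0 ≤ C := (abs_nonneg _).trans (hC x)
  -- Along the ray from `y` through `x` the function grows at least linearly with slope
  -- `f x - f y`; at this `t` the growth `2 * C + (f x - f y)` exceeds the oscillation `2 * C`.
  set t : ℝ := 2 * C / (f x - f y) + 1 with ht
  have ht1 : 1 ≤ t := le_add_of_nonneg_left (by positivity)
  have ht0 : 0 < t := one_pos.trans_le ht1
  have hcv := hf.2 (mem_univ y) (mem_univ (y + t • (x - y)))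
    (sub_nonneg.2 (inv_le_one_of_one_le₀ ht1)) (inv_pos.2 ht0).le (sub_add_cancel 1 t⁻¹)
  have hx : (1 - t⁻¹) • y + t⁻¹ • (y + t • (x - y)) = x := by
    rw [smul_add, smul_smul, inv_mul_cancel₀ ht0.ne']
    module
  rw [hx, smul_eq_mul, smul_eq_mul] at hcv
  have h1 : t * (f x - f y) ≤ f (y + t • (x - y)) - f y := by
    have h2 := mul_le_mul_of_nonneg_left hcv ht0.le
    rw [mul_add, ← mul_assoc, ← mul_assoc, mul_sub, mul_inv_cancel₀ ht0.ne'] at h2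
    linarith
  have h3 : t * (f x - f y) = 2 * C + (f x - f y) := by
    rw [ht, add_mul, div_mul_cancel₀ _ hδ.ne', one_mul]
  linarith [(abs_le.1 (hC (y + t • (x - y)))).2, (abs_le.1 (hC y)).1]

theorem abs_gaussianSmoothing_le {d : ℕ} {f : EuclideanSpace ℝ (Fin d) → ℝ} {C : ℝ}
    (hC : ∀ x, |f x| ≤ C) (σ : ℝ) (x : EuclideanSpace ℝ (Fin d)) :
    |gaussianSmoothing f σ x| ≤ C := by
  rw [gaussianSmoothing_eq_integral]
  simpa using norm_integral_le_of_norm_le_const (μ := gaussianMeasure d)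
    (f := fun u => f (x + σ • u)) (C := C) (Eventually.of_forall fun u => hC _)

/-! ### The corollary -/

theorem corollary2p8 {d : ℕ} (f : EuclideanSpace ℝ (Fin d) → ℝ) (S A a : ℝ) (hS : 0 < S)
    (hex : ∀ σ : ℝ, 0 ≤ σ → σ ≤ S → SmoothingExists f σ)
    (hgrowth : ∀ σ : ℝ, 0 ≤ σ → σ ≤ S → ∀ x : EuclideanSpace ℝ (Fin d),
      |gaussianSmoothing f σ x| ≤ A * Real.exp (a * ‖x‖ ^ 2))
    (hheat : SolvesHeatEquation (fun t => gaussianSmoothing f (2 * √t)) f (S ^ 2 / 4)) :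
    -- (a)
    (∀ σ : ℝ, 0 ≤ σ → σ ≤ S → (∃ c : ℝ, ∀ x, gaussianSmoothing f σ x = c) →
      ∀ η : ℝ, 0 < η → SmoothingExists f η ∧
        gaussianSmoothing f η =ᵐ[volume] f ∧
        ∀ x, AttainsInitialValueAt f x → gaussianSmoothing f η x = f x) ∧
    -- (b)
    (∀ (g : EuclideanSpace ℝ (Fin d) → ℝ) (B b : ℝ),
      (∀ σ : ℝ, 0 ≤ σ → σ ≤ S → SmoothingExists g σ) →
      (∀ σ : ℝ, 0 ≤ σ → σ ≤ S → ∀ x : EuclideanSpace ℝ (Fin d),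
        |gaussianSmoothing g σ x| ≤ B * Real.exp (b * ‖x‖ ^ 2)) →
      ∀ σ : ℝ, 0 ≤ σ → σ ≤ S →
        (∀ x, gaussianSmoothing f σ x = gaussianSmoothing g σ x) → f =ᵐ[volume] g) ∧
    -- (c)
    (∀ σ : ℝ, 0 < σ → σ ≤ S →
      (∀ τ : ℝ, σ ≤ τ → SmoothingExists f τ ∧
        ∀ x, gaussianSmoothing f σ x = gaussianSmoothing f τ x) →
      ∀ η : ℝ, 0 < η → SmoothingExists f η ∧ f =ᵐ[volume] gaussianSmoothing f η) ∧
    -- (d)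
    ((∃ C : ℝ, ∀ x, |f x| ≤ C) → ¬ ConvexOn ℝ univ f →
      ((∀ x, AttainsInitialValueAt f x) ∨
        ∀ h : EuclideanSpace ℝ (Fin d) → ℝ, ConvexOn ℝ univ h → ¬ f =ᵐ[volume] h) →
      ∀ σ : ℝ, 0 ≤ σ → SmoothingExists f σ ∧ ¬ ConvexOn ℝ univ (gaussianSmoothing f σ)) := by
  refine ⟨?_, ?_, ?_, ?_⟩
  · rintro σ hσ0 hσS ⟨c, hc⟩ η hη
    have hfc : f =ᵐ[volume] fun _ => c :=
      ae_eq_of_gaussianSmoothing_eq hσ0 (hex σ hσ0 hσS) (smoothingExists_const c σ)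
        (by simpa only [gaussianSmoothing_const] using hc)
    obtain ⟨h1, h2⟩ := gaussianSmoothing_congr_ae hfc hη
    rw [gaussianSmoothing_const] at h2
    refine ⟨h1 (smoothingExists_const c η), h2 ▸ hfc.symm, fun x hx => ?_⟩
    rw [h2, hx.eq_of_ae_eq_const hfc]
  · intro g B b hg _ σ hσ0 hσS h
    exact ae_eq_of_gaussianSmoothing_eq hσ0 (hex σ hσ0 hσS) (hg σ hσ0 hσS) h
  · intro σ hσ0 hσS hτ η hη
    have hfη : SmoothingExists f η := by
      rcases le_total σ η with h | h
      · exact (hτ η h).1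
      · exact hex η hη.le (h.trans hσS)
    have hr : σ ≤ √(σ ^ 2 + η ^ 2) := Real.le_sqrt_of_sq_le (by nlinarith)
    obtain ⟨h1, h2⟩ := SmoothingExists.semigroup hσ0 (hτ _ hr).1
    exact ⟨hfη, ae_eq_of_gaussianSmoothing_eq hσ0.le (hex σ hσ0.le hσS) h1
      fun x => ((hτ _ hr).2 x).trans (h2 x).symm⟩
  · rintro ⟨C, hC⟩ hnc hcase σ hσ
    have hfσ := smoothingExists_of_bounded hS (hex S hS.le le_rfl) hC hσ
    refine ⟨hfσ, fun hconv => ?_⟩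
    have hfc : f =ᵐ[volume] fun _ => gaussianSmoothing f σ 0 :=
      ae_eq_of_gaussianSmoothing_eq hσ hfσ (smoothingExists_const _ σ) fun x => by
        rw [gaussianSmoothing_const]
        exact hconv.eq_of_bounded (abs_gaussianSmoothing_le hC σ) x 0
    rcases hcase with h | h
    · refine hnc ?_
      rw [show f = fun _ => gaussianSmoothing f σ 0 from
        funext fun x => (h x).eq_of_ae_eq_const hfc]
      exact convexOn_const _ convex_univ
    · exact h _ (convexOn_const _ convex_univ) hfc
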